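/- Let $0\le d\le D$ be integers. Let $G(D,d)$ be the Grassmannian of $d$-dimensional linear subspaces of the Euclidean space $\mathbb{R}^D$ and let $dV$ be the orthogonally invariant probability measure on it. For $V\in G(D,d)$ let $\pi_V\in\mathbb{R}^{d\times D}$ be the matrix of the orthogonal projector on $V$ written in an orthonormal basis of $V$, that is, a matrix whose rows form an orthonormal basis of $V$ (the quantity $|\det(M\pi_V^\top)|$ does not depend on the choice of the basis). For $0\le m\le D$ put $$c_{D,m}:=\pi^{1/2}\,\frac{\Gamma\left(\frac{D+1}{2}\right)}{\Gamma\left(\frac{m+1}{2}\right)\Gamma\left(\frac{D-m+1}{2}\right)}.$$ (i) For every matrix $M\in\mathbb{R}^{d\times D}$, the function $V\mapsto|\det(M\pi_V^\top)|$ is integrable on $G(D,d)$ and $$\sqrt{\left|\det MM^\top\right|}=c_{D,D-d}\int_{G(D,d)}\left|\det(M\pi_V^\top)\right|\,dV .$$ (ii) If $X$ is a random $d\times D$ matrix whose entries are independent standard Gaussian $N(0,1)$ random variables, then $\sqrt{|\det XX^\top|}$ is integrable and $$\mathbb{E}\sqrt{\left|\det XX^\top\right|}=2^{d/2}\,\frac{\Gamma\left(\frac{D+1}{2}\right)}{\Gamma\left(\frac{D-d+1}{2}\right)}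 .$$ -/

import Mathlib

open MeasureTheory ProbabilityTheory

/-- The constant `c_{D,m} = π^{1/2} Γ((D+1)/2) / (Γ((m+1)/2) Γ((D-m+1)/2))` of Crofton's formula. -/
noncomputable def croftonConst (D m : ℕ) : ℝ :=
  Real.sqrt Real.pi * Real.Gamma (((D : ℝ) + 1) / 2) /
    (Real.Gamma (((m : ℝ) + 1) / 2) * Real.Gamma (((D : ℝ) - (m : ℝ) + 1) / 2))

/-- The Grassmannian `G(D,d)` of `d`-dimensional linear subspaces of Euclidean `ℝ^D`. -/
def Grass (D d : ℕ) : Type :=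
  {V : Submodule ℝ (EuclideanSpace ℝ (Fin D)) // Module.finrank ℝ V = d}

namespace Grass

/-- The usual topology: a subspace is identified with the orthogonal projector on it. -/
noncomputable instance instTopologicalSpace (D d : ℕ) : TopologicalSpace (Grass D d) :=
  TopologicalSpace.induced (fun V => V.1.starProjection) inferInstance

noncomputable instance instMeasurableSpace (D d : ℕ) : MeasurableSpace (Grass D d) := borel _

instance instBorelSpace (D d : ℕ) : BorelSpace (Grass D d) := ⟨rfl⟩

end Grass

/-- The orthogonal group `O(D)`, with its topology as a space of matrices. -/
abbrev OGroup (D : ℕ) : Type := Matrix.orthogonalGroup (Fin D) ℝ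

namespace OGroup

instance instMeasurableSpace (D : ℕ) : MeasurableSpace (OGroup D) := borel _

instance instBorelSpace (D : ℕ) : BorelSpace (OGroup D) := ⟨rfl⟩

instance instIsTopologicalGroup (D : ℕ) : IsTopologicalGroup (OGroup D) :=
  inferInstanceAs (IsTopologicalGroup (unitary (Matrix (Fin D) (Fin D) ℝ)))

instance instCompactSpace (D : ℕ) : CompactSpace (OGroup D) := by
  apply isCompact_iff_compactSpace.mp
  have hc : IsCompact (Set.univ.pi fun _ : Fin D => Set.univ.pi fun _ : Fin D =>
      Metric.closedBall (0 : ℝ) 1) :=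
    isCompact_univ_pi fun _ => isCompact_univ_pi fun _ => isCompact_closedBall _ _
  refine IsCompact.of_isClosed_subset (X := Matrix (Fin D) (Fin D) ℝ) hc isClosed_unitary ?_
  intro U hU i _ j _
  simpa using entry_norm_bound_of_unitary (𝕜 := ℝ) hU i j

/-- The action of an orthogonal matrix on `ℝ^D`. -/
noncomputable def toIsometry {D : ℕ} (Q : OGroup D) :
    EuclideanSpace ℝ (Fin D) ≃ₗᵢ[ℝ] EuclideanSpace ℝ (Fin D) :=
  Unitary.linearIsometryEquiv
    ⟨Matrix.toEuclideanCLM (n := Fin D) (𝕜 := ℝ) Q.1, Unitary.map_mem _ Q.2⟩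

theorem toIsometry_apply {D : ℕ} (Q : OGroup D) (x : EuclideanSpace ℝ (Fin D)) :
    toIsometry Q x = WithLp.toLp 2 (Q.1.mulVec x.ofLp) := rfl

theorem toIsometry_mul {D : ℕ} (Q R : OGroup D) (x : EuclideanSpace ℝ (Fin D)) :
    toIsometry (Q * R) x = toIsometry Q (toIsometry R x) := by
  simp [toIsometry_apply, Matrix.mulVec_mulVec]

/-- The Haar probability measure of the compact group `O(D)`. -/
noncomputable def haarProb (D : ℕ) : Measure (OGroup D) := Measure.haarMeasure ⊤

instance instIsProbabilityMeasure (D : ℕ) : IsProbabilityMeasure (haarProb D) :=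
  ⟨by simpa [haarProb] using Measure.haarMeasure_self (K₀ := (⊤ : TopologicalSpace.PositiveCompacts (OGroup D)))⟩

end OGroup

namespace Grass

/-- The action of `O(D)` on `G(D,d)`: `Q` sends `V` to its image `Q V`. -/
noncomputable def act {D d : ℕ} (Q : OGroup D) (V : Grass D d) : Grass D d :=
  ⟨V.1.map (OGroup.toIsometry Q).toLinearEquiv.toLinearMap, by
    rw [LinearEquiv.finrank_map_eq]; exact V.2⟩

/-- The coordinate subspace spanned by the first `d` vectors of the canonical basis. -/
noncomputable def base {D d : ℕ} (h : d ≤ D) : Grass D d :=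
  ⟨Submodule.span ℝ
      (Set.range fun i : Fin d => EuclideanSpace.basisFun (Fin D) ℝ (Fin.castLE h i)), by
    have := ((EuclideanSpace.basisFun (Fin D) ℝ).orthonormal.linearIndependent).comp
      (Fin.castLE h) (Fin.castLE_injective h)
    simpa [Function.comp_def] using finrank_span_eq_card this⟩

theorem act_mul {D d : ℕ} (Q R : OGroup D) (V : Grass D d) :
    act (Q * R) V = act Q (act R V) := by
  apply Subtype.ext
  simp only [act, ← Submodule.map_comp]
  congr 1
  exact LinearMap.ext fun x => OGroup.toIsometry_mul Q R x

theorem starProjection_act {D d : ℕ} (Q : OGroup D) (V : Grass D d) :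
    (act Q V).1.starProjection =
      Matrix.toEuclideanCLM (n := Fin D) (𝕜 := ℝ) Q.1 * V.1.starProjection *
        Matrix.toEuclideanCLM (n := Fin D) (𝕜 := ℝ) (Q⁻¹).1 := by
  ext1 x
  have h := Submodule.starProjection_map_apply (OGroup.toIsometry Q) V.1 x
  have h2 : (OGroup.toIsometry Q).symm x =
      Matrix.toEuclideanCLM (n := Fin D) (𝕜 := ℝ) (Q⁻¹).1 x := by
    rw [LinearIsometryEquiv.symm_apply_eq]
    change x = OGroup.toIsometry Q (OGroup.toIsometry Q⁻¹ x)
    rw [← OGroup.toIsometry_mul]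
    simp [OGroup.toIsometry_apply]
  rw [h2] at h
  exact h

theorem continuous_toEuclideanCLM (D : ℕ) :
    Continuous (fun A : Matrix (Fin D) (Fin D) ℝ =>
      Matrix.toEuclideanCLM (n := Fin D) (𝕜 := ℝ) A) :=
  LinearMap.continuous_of_finiteDimensional
    (Matrix.toEuclideanCLM (n := Fin D) (𝕜 := ℝ)).toAlgEquiv.toLinearMap

theorem continuous_act {D d : ℕ} :
    Continuous fun p : OGroup D × Grass D d => act p.1 p.2 := by
  refine continuous_induced_rng.2 ?_
  have h1 : Continuous fun p : OGroup D × Grass D d =>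
      Matrix.toEuclideanCLM (n := Fin D) (𝕜 := ℝ) p.1.1 :=
    (continuous_toEuclideanCLM D).comp (continuous_subtype_val.comp continuous_fst)
  have h2 : Continuous fun p : OGroup D × Grass D d =>
      Matrix.toEuclideanCLM (n := Fin D) (𝕜 := ℝ) (p.1⁻¹).1 :=
    (continuous_toEuclideanCLM D).comp (continuous_subtype_val.comp continuous_fst.inv)
  have h3 : Continuous fun p : OGroup D × Grass D d => p.2.1.starProjection :=
    Continuous.comp (g := fun V : Grass D d => V.1.starProjection)
      continuous_induced_dom continuous_snd
  exact ((h1.mul h3).mul h2).congr fun p => (starProjection_act p.1 p.2).symm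

/-- The orthogonally invariant probability measure on `G(D,d)`: the law of `Q V₀` for `Q`
distributed according to the Haar probability of `O(D)` and a fixed `d`-dimensional `V₀`. -/
noncomputable def invMeasure {D d : ℕ} (h : d ≤ D) : Measure (Grass D d) :=
  (OGroup.haarProb D).map fun Q => act Q (base h)

theorem measurable_act_base {D d : ℕ} (h : d ≤ D) :
    Measurable fun Q : OGroup D => act Q (base h) :=
  (continuous_act.comp (Continuous.prodMk_left (base h))).measurable

instance isProbabilityMeasure_invMeasure {D d : ℕ} (h : d ≤ D) :
    IsProbabilityMeasure (invMeasure h) :=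
  Measure.isProbabilityMeasure_map (measurable_act_base h).aemeasurable

theorem map_act_invMeasure {D d : ℕ} (h : d ≤ D) (R : OGroup D) :
    (invMeasure h).map (act R) = invMeasure h := by
  have hR : Measurable (act R : Grass D d → Grass D d) :=
    (continuous_act.comp (Continuous.prodMk_right R)).measurable
  have hL : Measurable fun Q : OGroup D => R * Q := (continuous_const_mul R).measurable
  have hinv : (OGroup.haarProb D).map (fun Q => R * Q) = OGroup.haarProb D :=
    haveI : (OGroup.haarProb D).IsMulLeftInvariant := by
      unfold OGroup.haarProb; infer_instance
    map_mul_left_eq_self _ R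
  unfold invMeasure
  rw [Measure.map_map hR (measurable_act_base h)]
  conv_rhs => rw [← hinv, Measure.map_map (measurable_act_base h) hL]
  congr 1
  funext Q
  exact (act_mul R Q _).symm

/-- `P` is a `d × D` matrix `π_V` of the orthogonal projector on `V`, written in an orthonormal
basis of `V`: the rows of `P` are an orthonormal basis of `V`. -/
def IsProjectorMatrix {D d : ℕ} (V : Grass D d) (P : Matrix (Fin d) (Fin D) ℝ) : Prop :=
  Orthonormal ℝ (fun i => (WithLp.toLp 2 (P i) : EuclideanSpace ℝ (Fin D))) ∧
    Submodule.span ℝ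
      (Set.range fun i => (WithLp.toLp 2 (P i) : EuclideanSpace ℝ (Fin D))) = V.1

theorem exists_isProjectorMatrix {D d : ℕ} (V : Grass D d) :
    ∃ P : Matrix (Fin d) (Fin D) ℝ, IsProjectorMatrix V P := by
  let b : OrthonormalBasis (Fin d) ℝ V.1 :=
    (stdOrthonormalBasis ℝ V.1).reindex (finCongr V.2)
  refine ⟨Matrix.of fun i j => (b i : EuclideanSpace ℝ (Fin D)) j, ?_, ?_⟩
  · exact b.orthonormal.comp_linearIsometry V.1.subtypeₗᵢ
  · have h := congrArg (Submodule.map V.1.subtype) b.toBasis.span_eq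
    rw [Submodule.map_span, ← Set.range_comp, Submodule.map_top, Submodule.range_subtype] at h
    exact h

end Grass

/-- A random `d × D` matrix `X` is standard Gaussian: its entries are i.i.d. `N(0,1)`. -/
def IsStdGaussianMatrix {Ω : Type*} [MeasurableSpace Ω] {d D : ℕ}
    (X : Ω → Matrix (Fin d) (Fin D) ℝ) (P : Measure Ω) : Prop :=
  iIndepFun (fun (ij : Fin d × Fin D) (ω : Ω) => X ω ij.1 ij.2) P ∧
    ∀ i j, HasLaw (fun ω => X ω i j) (gaussianReal 0 1) P

/-! Both parts rest on one Gaussian computation. Let `E = coordMatrix h`. Gram–Schmidt writes every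
`M` as `L * (E * R)` with `R` orthogonal, so that `√|det (M Mᵀ)| = |det L|`. Since `E * Q.1ᵀ` is a
projector matrix of `Q V₀`, the integral in (i) becomes a Haar average of `|det (M Q Eᵀ)| = |det L|
|det (E R Q Eᵀ)|`, and left invariance absorbs `R`. So (i) holds up to a constant `minorMean`
independent of `M` (`lintegral_abs_det_haarProb`).

The constant is found by averaging over Gaussian `M`: `M Q` has the law of `M`, so `M Q Eᵀ` is a
square Gaussian matrix, and `minorMean` is the ratio of the mean Gaussian volumes in dimensions `d`
and `D` (`minorMean_mul_gaussVolume`).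

These means, which are (ii), come from adding one row at a time. A new Gaussian row multiplies the
volume by its distance to a `d`-dimensional space containing the old rows, whose mean is `chiMean (D
- d)` (`lintegral_sqrt_det_gram_consRow`); the product telescopes. Computing with `lintegral` makes
integrability a consequence of the finite value. -/

/-! ### Gaussian vectors and the mean of their norm -/

/-- The standard Gaussian measure on `ℝ^n`. -/
noncomputable def gaussVec (n : ℕ) : Measure (Fin n → ℝ) :=
  Measure.pi fun _ => gaussianReal 0 1

instance isProbabilityMeasure_gaussVec (n : ℕ) : IsProbabilityMeasure (gaussVec n) := by
  unfold gaussVec; infer_instance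

/-- The law of a `d × D` matrix with independent standard Gaussian entries. -/
noncomputable def gaussMat (d D : ℕ) : Measure (Fin d → Fin D → ℝ) :=
  Measure.pi fun _ => gaussVec D

instance isProbabilityMeasure_gaussMat (d D : ℕ) : IsProbabilityMeasure (gaussMat d D) := by
  unfold gaussMat; infer_instance

theorem prod_gaussianPDFReal {n : ℕ} (x : Fin n → ℝ) :
    ∏ i, gaussianPDFReal 0 1 (x i) =
      ((Real.sqrt (2 * Real.pi))⁻¹) ^ n * Real.exp (-(1 / 2) * ∑ i, x i ^ 2) := by
  simp only [gaussianPDFReal, NNReal.coe_one, mul_one, sub_zero]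
  rw [Finset.prod_mul_distrib, ← Real.exp_sum, Finset.prod_const, Finset.card_univ,
    Fintype.card_fin, Finset.mul_sum]
  congr 2
  exact Finset.sum_congr rfl fun i _ => by ring

theorem gaussVec_eq_withDensity (n : ℕ) :
    gaussVec n = (volume : Measure (Fin n → ℝ)).withDensity
      fun x => ENNReal.ofReal (∏ i, gaussianPDFReal 0 1 (x i)) := by
  unfold gaussVec
  refine Measure.pi_eq fun s hs => ?_
  rw [withDensity_apply _ (MeasurableSet.univ_pi hs), volume_pi, Measure.restrict_pi_pi,
    ← ofReal_integral_eq_lintegral_ofReal]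
  · rw [integral_fintype_prod_eq_prod (f := fun _ x => gaussianPDFReal 0 1 x),
      ENNReal.ofReal_prod_of_nonneg
        (fun i _ => integral_nonneg fun x => gaussianPDFReal_nonneg _ _ _)]
    exact Finset.prod_congr rfl fun i _ =>
      (gaussianReal_apply_eq_integral 0 one_ne_zero (s i)).symm
  · exact Integrable.fintype_prod fun i => (integrable_gaussianPDFReal 0 1).restrict
  · exact Filter.Eventually.of_forall fun x =>
      Finset.prod_nonneg fun i _ => gaussianPDFReal_nonneg _ _ _

/-- The mean of the norm of a standard Gaussian vector of `ℝ^n`. -/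
noncomputable def chiMean (n : ℕ) : ℝ :=
  Real.sqrt 2 * Real.Gamma (((n : ℝ) + 1) / 2) / Real.Gamma ((n : ℝ) / 2)

theorem integral_pow_mul_exp_neg_half_mul_sq (m : ℕ) :
    ∫ r in Set.Ioi (0 : ℝ), r ^ m * Real.exp (-(1 / 2) * r ^ 2) =
      (1 / 2 : ℝ) ^ (-((m : ℝ) + 1) / 2) * (1 / 2) * Real.Gamma (((m : ℝ) + 1) / 2) := by
  rw [← integral_rpow_mul_exp_neg_mul_rpow (p := 2) (q := m) (b := 1 / 2) (by norm_num)
    (by have : (0 : ℝ) ≤ m := m.cast_nonneg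
        linarith) (by norm_num)]
  simp

theorem integrableOn_pow_mul_exp_neg_half_mul_sq (m : ℕ) :
    IntegrableOn (fun r : ℝ => r ^ m * Real.exp (-(1 / 2) * r ^ 2)) (Set.Ioi 0) := by
  have := (integrable_rpow_mul_exp_neg_mul_sq (b := 1 / 2) (by norm_num) (s := m)
    (by have : (0 : ℝ) ≤ m := m.cast_nonneg
        linarith)).integrableOn (s := Set.Ioi (0 : ℝ))
  simpa using this

/-- In polar coordinates the mean is a ratio of two radial Gaussian moments. -/
theorem lintegral_norm_gaussVec {n : ℕ} (hn : 0 < n) :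
    ∫⁻ x, ENNReal.ofReal (Real.sqrt (∑ i, x i ^ 2)) ∂gaussVec n =
      ENNReal.ofReal (chiMean n) := by
  obtain ⟨m, rfl⟩ : ∃ m, n = m + 1 := ⟨n - 1, by omega⟩
  let E := EuclideanSpace ℝ (Fin (m + 1))
  set C : ℝ := ((Real.sqrt (2 * Real.pi))⁻¹) ^ (m + 1) with hC
  have hnorm : ∀ x : Fin (m + 1) → ℝ, ‖(WithLp.toLp 2 x : E)‖ = Real.sqrt (∑ i, x i ^ 2) := by
    intro x
    rw [EuclideanSpace.norm_eq]
    simp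
  have transfer : ∀ g : ℝ → ℝ, ∫ x : E, g ‖x‖ =
      ∫ x : Fin (m + 1) → ℝ, g (Real.sqrt (∑ i, x i ^ 2)) := by
    intro g
    rw [← (PiLp.volume_preserving_toLp (Fin (m + 1))).integral_comp
      (MeasurableEquiv.toLp 2 _).measurableEmbedding]
    exact integral_congr_ae (Filter.Eventually.of_forall fun x => congrArg g (hnorm x))
  have hdim : Module.finrank ℝ E = m + 1 := by simp [E]
  have hpol : ∀ g : ℝ → ℝ, ∫ x : Fin (m + 1) → ℝ, g (Real.sqrt (∑ i, x i ^ 2)) =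
      ((m + 1 : ℕ) * (volume : Measure E).real (Metric.ball 0 1)) *
        ∫ y in Set.Ioi (0 : ℝ), y ^ m * g y := by
    intro g
    rw [← transfer, integral_fun_norm_addHaar (volume : Measure E), hdim]
    simp [mul_assoc]
  set K : ℝ := (m + 1 : ℕ) * (volume : Measure E).real (Metric.ball 0 1)
  have hsq : ∀ x : Fin (m + 1) → ℝ, Real.sqrt (∑ i, x i ^ 2) ^ 2 = ∑ i, x i ^ 2 := fun x =>
    Real.sq_sqrt (Finset.sum_nonneg fun i _ => sq_nonneg _)
  -- Total mass one determines `C * K`, so the volume of the unit ball is never computed.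
  have hone : C * (K * ∫ y in Set.Ioi (0 : ℝ), y ^ m * Real.exp (-(1 / 2) * y ^ 2)) = 1 := by
    rw [← hpol fun y => Real.exp (-(1 / 2) * y ^ 2), ← integral_const_mul]
    simp only [hsq, hC, ← prod_gaussianPDFReal]
    rw [volume_pi, integral_fintype_prod_eq_prod (f := fun _ x => gaussianPDFReal 0 1 x)]
    simp [integral_gaussianPDFReal_eq_one]
  have hmain : ∫ x : Fin (m + 1) → ℝ, (∏ i, gaussianPDFReal 0 1 (x i)) *
      Real.sqrt (∑ i, x i ^ 2) =
      C * (K * ∫ y in Set.Ioi (0 : ℝ), y ^ (m + 1) * Real.exp (-(1 / 2) * y ^ 2)) := by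
    have := hpol fun y => Real.exp (-(1 / 2) * y ^ 2) * y
    simp only [hsq] at this
    have h2 : ∀ y : ℝ, y ^ m * (Real.exp (-(1 / 2) * y ^ 2) * y) =
      y ^ (m + 1) * Real.exp (-(1 / 2) * y ^ 2) := fun y => by ring
    simp only [h2] at this
    rw [← this, ← integral_const_mul]
    simp only [prod_gaussianPDFReal, hC, mul_assoc]
  have hint : Integrable fun x : Fin (m + 1) → ℝ => (∏ i, gaussianPDFReal 0 1 (x i)) *
      Real.sqrt (∑ i, x i ^ 2) := by
    have h1 : Integrable (fun x : E => Real.exp (-(1 / 2) * ‖x‖ ^ 2) * ‖x‖) := by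
      refine (integrable_fun_norm_addHaar (volume : Measure E)
        (f := fun y => Real.exp (-(1 / 2) * y ^ 2) * y)).2 ?_
      rw [hdim]
      refine (integrableOn_pow_mul_exp_neg_half_mul_sq (m + 1)).congr_fun
        (fun y _ => ?_) measurableSet_Ioi
      simp only [Nat.add_sub_cancel, smul_eq_mul]
      ring
    have h2 := ((PiLp.volume_preserving_toLp (Fin (m + 1))).integrable_comp_emb
      (MeasurableEquiv.toLp 2 _).measurableEmbedding).2 h1
    refine (h2.const_mul C).congr (Filter.Eventually.of_forall fun x => ?_)
    change C * (Real.exp (-(1 / 2) * ‖(WithLp.toLp 2 x : E)‖ ^ 2) * ‖(WithLp.toLp 2 x : E)‖) = _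
    rw [hnorm, hsq]
    simp only [prod_gaussianPDFReal, hC, mul_assoc]
  have hmeas : Measurable fun x : Fin (m + 1) → ℝ => Real.sqrt (∑ i, x i ^ 2) := by fun_prop
  have hpdf : Measurable fun x : Fin (m + 1) → ℝ => ∏ i, gaussianPDFReal 0 1 (x i) :=
    Finset.measurable_prod _ fun i _ =>
      (measurable_gaussianPDFReal 0 1).comp (measurable_pi_apply i)
  have hp0 : ∀ x : Fin (m + 1) → ℝ, 0 ≤ ∏ i, gaussianPDFReal 0 1 (x i) := fun x =>
    Finset.prod_nonneg fun i _ => gaussianPDFReal_nonneg _ _ _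
  rw [gaussVec_eq_withDensity, lintegral_withDensity_eq_lintegral_mul _ hpdf.ennreal_ofReal
    hmeas.ennreal_ofReal]
  simp only [Pi.mul_apply, ← ENNReal.ofReal_mul (hp0 _)]
  rw [← ofReal_integral_eq_lintegral_ofReal hint
    (Filter.Eventually.of_forall fun x => mul_nonneg (hp0 x) (Real.sqrt_nonneg _)), hmain]
  congr 1
  rw [integral_pow_mul_exp_neg_half_mul_sq] at hone ⊢
  have hG : Real.Gamma (((m : ℝ) + 1) / 2) ≠ 0 := (Real.Gamma_pos_of_pos (by positivity)).ne'
  -- One more power of `r` costs `(1/2)^(-1/2) = √2`, the factor in `chiMean`.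
  have hpow : (1 / 2 : ℝ) ^ (-(((m + 1 : ℕ) : ℝ) + 1) / 2) =
      Real.sqrt 2 * (1 / 2 : ℝ) ^ (-((m : ℝ) + 1) / 2) := by
    rw [show (-(((m + 1 : ℕ) : ℝ) + 1) / 2) = -(1 / 2 : ℝ) + (-((m : ℝ) + 1) / 2) by
      push_cast; ring, Real.rpow_add (by norm_num)]
    congr 1
    rw [one_div, Real.inv_rpow (by norm_num), Real.rpow_neg (by norm_num), inv_inv,
      Real.sqrt_eq_rpow, one_div]
  rw [hpow]
  unfold chiMean
  rw [eq_div_iff (by push_cast; exact hG)]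
  push_cast
  linear_combination (Real.sqrt 2 * Real.Gamma (((m : ℝ) + 1 + 1) / 2)) * hone

/-! ### Orthonormal frames and Gram determinants -/

/-- The `d × D` matrix whose rows are the first `d` vectors of the canonical basis. -/
def coordMatrix {d D : ℕ} (h : d ≤ D) : Matrix (Fin d) (Fin D) ℝ :=
  (1 : Matrix (Fin D) (Fin D) ℝ).submatrix (Fin.castLE h) id

theorem coordMatrix_mul {d D : ℕ} (h : d ≤ D) {n : Type*} (A : Matrix (Fin D) n ℝ) :
    coordMatrix h * A = A.submatrix (Fin.castLE h) id := by
  ext i j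
  simp [coordMatrix, Matrix.mul_apply, Matrix.one_apply]

theorem mul_coordMatrix_transpose {d D : ℕ} (h : d ≤ D) {n : Type*} (A : Matrix n (Fin D) ℝ) :
    A * (coordMatrix h).transpose = A.submatrix id (Fin.castLE h) := by
  ext i j
  simp [coordMatrix, Matrix.mul_apply, Matrix.one_apply]

theorem coordMatrix_mulVec {d D : ℕ} (h : d ≤ D) (x : Fin D → ℝ) :
    (coordMatrix h).mulVec x = x ∘ Fin.castLE h := by
  ext i
  simp [coordMatrix, Matrix.mulVec, dotProduct, Matrix.one_apply]

theorem coordMatrix_mul_transpose {d D : ℕ} (h : d ≤ D) :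
    coordMatrix h * (coordMatrix h).transpose = 1 := by
  rw [mul_coordMatrix_transpose, coordMatrix, Matrix.submatrix_submatrix]
  exact Matrix.submatrix_one _ (Fin.castLE_injective h)

theorem OGroup.mul_transpose {D : ℕ} (Q : OGroup D) : Q.1 * Q.1.transpose = 1 :=
  Matrix.mem_orthogonalGroup_iff _ _ |>.1 Q.2

theorem OGroup.transpose_mul {D : ℕ} (Q : OGroup D) : Q.1.transpose * Q.1 = 1 :=
  Matrix.mem_orthogonalGroup_iff' _ _ |>.1 Q.2

/-- Every `d × D` matrix with `d ≤ D` is the product of a square matrix with the first `d` rows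
of an orthogonal matrix. -/
theorem exists_eq_mul_coordMatrix_mul {d D : ℕ} (h : d ≤ D) (M : Matrix (Fin d) (Fin D) ℝ) :
    ∃ (L : Matrix (Fin d) (Fin d) ℝ) (Q : OGroup D), M = L * (coordMatrix h * Q.1) := by
  -- Padding the rows by zeros to `D` vectors yields a full orthonormal basis; dependent rows only
  -- make `L` singular.
  let f : Fin D → EuclideanSpace ℝ (Fin D) := fun k =>
    if hk : k.1 < d then WithLp.toLp 2 (M ⟨k, hk⟩) else 0
  have hf : ∀ i : Fin d, f (Fin.castLE h i) = WithLp.toLp 2 (M i) := fun i => by simp [f]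
  let b := InnerProductSpace.gramSchmidtOrthonormalBasis (𝕜 := ℝ)
    (finrank_euclideanSpace_fin (𝕜 := ℝ) (n := D) |>.trans (Fintype.card_fin D).symm) f
  have hQ : (Matrix.of fun k j => b k j) ∈ Matrix.orthogonalGroup (Fin D) ℝ := by
    rw [Matrix.mem_orthogonalGroup_iff]
    ext k l
    have := orthonormal_iff_ite.1 b.orthonormal k l
    rw [Matrix.one_apply, ← this]
    simp [Matrix.mul_apply, PiLp.inner_apply, mul_comm]
  refine ⟨Matrix.of fun i k => inner ℝ (b (Fin.castLE h k)) (f (Fin.castLE h i)), ⟨_, hQ⟩, ?_⟩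
  rw [coordMatrix_mul]
  ext i j
  have h1 : M i j = (f (Fin.castLE h i)) j := by rw [hf]
  rw [h1, ← b.sum_repr' (f (Fin.castLE h i))]
  have h2 : (∑ k, inner ℝ (b k) (f (Fin.castLE h i)) • b k) j =
      ∑ k, inner ℝ (b k) (f (Fin.castLE h i)) * b k j := by simp
  rw [h2, Matrix.mul_apply]
  simp only [Matrix.of_apply, Matrix.submatrix_apply, id]
  symm
  refine Finset.sum_of_injOn (Fin.castLE h) (Fin.castLE_injective h).injOn (by simp)
    (fun k _ hk => ?_) (fun k _ => rfl)
  -- The discarded indices are `k ≥ d > i`, where triangularity of Gram–Schmidt kills the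
  -- coefficient.
  have hk' : Fin.castLE h i < k := by
    by_contra hc
    have hlt : k.1 < d := lt_of_le_of_lt (not_lt.1 hc) i.2
    exact hk ⟨⟨k, hlt⟩, by simp, rfl⟩
  rw [InnerProductSpace.gramSchmidtOrthonormalBasis_inv_triangular _ f hk', zero_mul]

theorem det_mul_transpose_mul_coordMatrix_mul {d D : ℕ} (h : d ≤ D)
    (L : Matrix (Fin d) (Fin d) ℝ) (Q : OGroup D) :
    ((L * (coordMatrix h * Q.1)) * (L * (coordMatrix h * Q.1)).transpose).det = L.det ^ 2 := by
  have : (L * (coordMatrix h * Q.1)) * (L * (coordMatrix h * Q.1)).transpose =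
      L * L.transpose := by
    simp only [Matrix.transpose_mul]
    calc _ = L * (coordMatrix h * (Q.1 * Q.1.transpose) * (coordMatrix h).transpose) *
          L.transpose := by simp only [Matrix.mul_assoc]
      _ = _ := by rw [OGroup.mul_transpose, Matrix.mul_one, coordMatrix_mul_transpose,
          Matrix.mul_one]
  rw [this, Matrix.det_mul, Matrix.det_transpose, sq]

/-- The matrix `M` with the row `x` added on top. -/
def consRow {d D : ℕ} (x : Fin D → ℝ) (M : Matrix (Fin d) (Fin D) ℝ) :
    Matrix (Fin (d + 1)) (Fin D) ℝ :=
  Matrix.of (Fin.cons x fun i => M i)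

@[simp]
theorem consRow_zero {d D : ℕ} (x : Fin D → ℝ) (M : Matrix (Fin d) (Fin D) ℝ) (j : Fin D) :
    consRow x M 0 j = x j := rfl

@[simp]
theorem consRow_succ {d D : ℕ} (x : Fin D → ℝ) (M : Matrix (Fin d) (Fin D) ℝ) (i : Fin d)
    (j : Fin D) : consRow x M i.succ j = M i j := rfl

/-- The Gram determinant of a family enlarged by one vector `x`, the family being written in
terms of the orthonormal rows of `R`. -/
theorem det_gram_consRow {d D : ℕ} (L : Matrix (Fin d) (Fin d) ℝ) (R : Matrix (Fin d) (Fin D) ℝ)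
    (hR : R * R.transpose = 1) (x : Fin D → ℝ) :
    (consRow x (L * R) * (consRow x (L * R)).transpose).det =
      L.det ^ 2 * (x ⬝ᵥ x - R.mulVec x ⬝ᵥ R.mulVec x) := by
  set c := R.mulVec x with hc
  -- `y` is the component of `x` orthogonal to the rows of `R`.
  set y := x - Matrix.vecMul c R with hy
  have hcR : R.mulVec (Matrix.vecMul c R) = c := by
    rw [← Matrix.mulVec_transpose, Matrix.mulVec_mulVec, hR, Matrix.one_mulVec]
  have hRy : R.mulVec y = 0 := by rw [hy, Matrix.mulVec_sub, hcR, ← hc, sub_self]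
  have hyy : y ⬝ᵥ y = x ⬝ᵥ x - c ⬝ᵥ c := by
    have h1 : Matrix.vecMul c R ⬝ᵥ y = 0 := by
      rw [← Matrix.dotProduct_mulVec, hRy, dotProduct_zero]
    have h2 : x ⬝ᵥ Matrix.vecMul c R = c ⬝ᵥ c := by
      rw [dotProduct_comm, ← Matrix.dotProduct_mulVec, ← hc]
    calc y ⬝ᵥ y = x ⬝ᵥ y := by
          conv_lhs => rw [hy]
          rw [sub_dotProduct, ← hy, h1, sub_zero]
      _ = _ := by rw [hy, dotProduct_sub, h2]
  -- `U` is the block matrix `[1, c; 0, L]`. The rows of `Y` are `y` and those of `R`, so `Y Yᵀ` is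
  -- diagonal with entries `y ⬝ᵥ y, 1, …, 1`.
  let U : Matrix (Fin (d + 1)) (Fin (d + 1)) ℝ :=
    consRow (Fin.cons 1 c) (Matrix.of fun i => Fin.cons 0 (L i))
  let Y : Matrix (Fin (d + 1)) (Fin D) ℝ := consRow y R
  have hUY : consRow x (L * R) = U * Y := by
    ext i j
    refine Fin.cases ?_ (fun i => ?_) i
    · simp [U, Y, Matrix.mul_apply, Fin.sum_univ_succ, hy, Matrix.vecMul, dotProduct]
    · simp [U, Y, Matrix.mul_apply, Fin.sum_univ_succ]
  have hU : U.det = L.det := by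
    rw [Matrix.det_succ_column_zero, Fin.sum_univ_succ]
    have : U.submatrix (Fin.succAbove 0) Fin.succ = L := by
      ext i j; simp [U]
    rw [this]
    simp [U]
  have hYY : (Y * Y.transpose).det = y ⬝ᵥ y := by
    rw [Matrix.det_succ_column_zero, Fin.sum_univ_succ]
    have h1 : (Y * Y.transpose).submatrix (Fin.succAbove 0) Fin.succ = 1 := by
      rw [← hR]
      ext i j; simp [Y, Matrix.mul_apply]
    have h2 : ∀ i : Fin d, (Y * Y.transpose) i.succ 0 = 0 := fun i => by
      have := congrFun hRy i
      simpa [Y, Matrix.mul_apply, Matrix.mulVec, dotProduct] using this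
    have h3 : (Y * Y.transpose) 0 0 = y ⬝ᵥ y := by simp [Y, Matrix.mul_apply, dotProduct]
    rw [h1, h3]
    simp [h2]
  rw [hUY, Matrix.transpose_mul, show U * Y * (Y.transpose * U.transpose) =
    U * (Y * Y.transpose) * U.transpose by simp only [Matrix.mul_assoc], Matrix.det_mul,
    Matrix.det_mul, Matrix.det_transpose, hU, hYY, hyy]
  ring

/-! ### Invariance of the Gaussian laws -/

/-- `gaussVec` is `stdGaussian` read in coordinates, and the latter is invariant under linear
isometries. -/
theorem measurePreserving_mulVec_gaussVec {D : ℕ} (Q : OGroup D) :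
    MeasurePreserving (fun x => Q.1.mulVec x) (gaussVec D) (gaussVec D) := by
  have hof : Measurable (WithLp.ofLp : EuclideanSpace ℝ (Fin D) → _) :=
    (MeasurableEquiv.toLp 2 (Fin D → ℝ)).symm.measurable
  have hto : Measurable (WithLp.toLp 2 : (Fin D → ℝ) → EuclideanSpace ℝ (Fin D)) :=
    (MeasurableEquiv.toLp 2 (Fin D → ℝ)).measurable
  have hg : gaussVec D = (stdGaussian (EuclideanSpace ℝ (Fin D))).map WithLp.ofLp := by
    rw [← map_pi_eq_stdGaussian, Measure.map_map hof hto]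
    exact (Measure.map_id).symm
  have hm : Measurable fun x : Fin D → ℝ => Q.1.mulVec x :=
    (Continuous.matrix_mulVec continuous_const continuous_id).measurable
  refine ⟨hm, ?_⟩
  conv_rhs => rw [hg, ← stdGaussian_map (OGroup.toIsometry Q)]
  rw [hg, Measure.map_map hm hof,
    Measure.map_map hof (OGroup.toIsometry Q).continuous.measurable]
  rfl

theorem measurePreserving_vecMul_gaussVec {D : ℕ} (Q : OGroup D) :
    MeasurePreserving (fun x => Matrix.vecMul x Q.1) (gaussVec D) (gaussVec D) := by
  have := measurePreserving_mulVec_gaussVec Q⁻¹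
  convert! this using 2 with x
  rw [← Matrix.mulVec_transpose]
  rfl

theorem measurePreserving_mul_gaussMat {d D : ℕ} (Q : OGroup D) :
    MeasurePreserving (fun X : Fin d → Fin D → ℝ => fun i => Matrix.vecMul (X i) Q.1)
      (gaussMat d D) (gaussMat d D) :=
  measurePreserving_pi _ _ fun _ => measurePreserving_vecMul_gaussVec Q

theorem measurePreserving_comp_gaussVec {m n : ℕ} (e : Fin m → Fin n)
    (he : Function.Injective e) :
    MeasurePreserving (fun x => x ∘ e) (gaussVec n) (gaussVec m) := by
  have hl : ∀ i : Fin m, HasLaw (fun x : Fin n → ℝ => x (e i)) (gaussianReal 0 1) (gaussVec n) :=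
    fun i => ⟨(measurable_pi_apply _).aemeasurable,
      (measurePreserving_eval (fun _ : Fin n => gaussianReal 0 1) (e i)).map_eq⟩
  have hi : iIndepFun (fun (i : Fin n) (x : Fin n → ℝ) => x i) (gaussVec n) :=
    iIndepFun_pi (μ := fun _ : Fin n => gaussianReal 0 1) (X := fun _ x => x)
      fun _ => aemeasurable_id
  exact ⟨by fun_prop, ((hi.precomp he).hasLaw_pi hl).map_eq⟩

theorem measurePreserving_submatrix_gaussMat {d m n : ℕ} (e : Fin m → Fin n)
    (he : Function.Injective e) :
    MeasurePreserving (fun X : Fin d → Fin n → ℝ => fun i => X i ∘ e)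
      (gaussMat d n) (gaussMat d m) :=
  measurePreserving_pi _ _ fun _ => measurePreserving_comp_gaussVec e he

/-- Independence is indexed by pairs, while `gaussMat` is an iterated product; currying carries one
law to the other. -/
theorem IsStdGaussianMatrix.hasLaw_gaussMat {Ω : Type*} [MeasurableSpace Ω] {P : Measure Ω}
    {d D : ℕ} {X : Ω → Matrix (Fin d) (Fin D) ℝ} (hX : IsStdGaussianMatrix X P) :
    HasLaw (fun ω => (fun i j => X ω i j : Fin d → Fin D → ℝ)) (gaussMat d D) P := by
  have h1 := iIndepFun.hasLaw_pi (fun p : Fin d × Fin D => hX.2 p.1 p.2) hX.1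
  have hc := (MeasurableEquiv.curry (Fin d) (Fin D) ℝ).measurable
  refine ⟨hc.comp_aemeasurable h1.aemeasurable, ?_⟩
  have h2 := Measure.infinitePi_map_curry (fun (_ : Fin d) (_ : Fin D) => gaussianReal 0 1)
  simp only [Measure.infinitePi_eq_pi] at h2
  rw [gaussMat]
  unfold gaussVec
  rw [← h2, ← h1.map_eq, AEMeasurable.map_map_of_aemeasurable hc.aemeasurable h1.aemeasurable]
  rfl

/-! ### Measurability of determinants -/

theorem measurable_det_of_entries {α : Type*} [MeasurableSpace α] {n : ℕ}
    {A : α → Matrix (Fin n) (Fin n) ℝ} (hA : ∀ i j, Measurable fun a => A a i j) :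
    Measurable fun a => (A a).det := by
  simp only [Matrix.det_apply]
  exact Finset.measurable_sum _ fun σ _ =>
    (Finset.measurable_prod _ fun i _ => hA _ _).const_smul _

theorem measurable_mul_entries {α l m n : Type*} [MeasurableSpace α] [Fintype m]
    {A : α → Matrix l m ℝ} {B : α → Matrix m n ℝ} (hA : ∀ i j, Measurable fun a => A a i j)
    (hB : ∀ i j, Measurable fun a => B a i j) (i : l) (j : n) :
    Measurable fun a => (A a * B a) i j := by
  simp only [Matrix.mul_apply]
  exact Finset.measurable_sum _ fun k _ => (hA _ _).mul (hB _ _)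

theorem measurable_sqrt_abs_det_gram {α : Type*} [MeasurableSpace α] {d D : ℕ}
    {A : α → Matrix (Fin d) (Fin D) ℝ} (hA : ∀ i j, Measurable fun a => A a i j) :
    Measurable fun a => Real.sqrt |(A a * (A a).transpose).det| :=
  (_root_.continuous_abs.measurable.comp (measurable_det_of_entries
    (measurable_mul_entries hA fun i j => hA j i))).sqrt

/-! ### Mean volume of a Gaussian matrix -/

/-- Removing the first `d` squares leaves the squared norm of the last `D - d` coordinates,
themselves a standard Gaussian vector. -/
theorem lintegral_sqrt_sub_coordMatrix {d D : ℕ} (h : d < D) :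
    ∫⁻ x, ENNReal.ofReal (Real.sqrt (x ⬝ᵥ x -
      (coordMatrix h.le).mulVec x ⬝ᵥ (coordMatrix h.le).mulVec x)) ∂gaussVec D =
      ENNReal.ofReal (chiMean (D - d)) := by
  obtain ⟨n, rfl⟩ := Nat.exists_eq_add_of_lt h
  rw [show d + n + 1 - d = n + 1 by omega, ← lintegral_norm_gaussVec n.succ_pos,
    ← (measurePreserving_comp_gaussVec (n := d + (n + 1)) (Fin.natAdd d)
      (Fin.natAdd_injective _ _)).lintegral_comp (by fun_prop)]
  refine lintegral_congr fun x => ?_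
  congr 2
  rw [coordMatrix_mulVec, sub_eq_iff_eq_add']
  simp only [dotProduct, ← sq]
  exact Fin.sum_univ_add (a := d) (b := n + 1) fun i => x i ^ 2

/-- The mean of the volume spanned by `M` and a standard Gaussian vector. -/
theorem lintegral_sqrt_det_gram_consRow {d D : ℕ} (h : d < D) (M : Matrix (Fin d) (Fin D) ℝ) :
    ∫⁻ x, ENNReal.ofReal (Real.sqrt |(consRow x M * (consRow x M).transpose).det|) ∂gaussVec D =
      ENNReal.ofReal (Real.sqrt |(M * M.transpose).det|) * ENNReal.ofReal (chiMean (D - d)) := by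
  obtain ⟨L, Q, rfl⟩ := exists_eq_mul_coordMatrix_mul h.le M
  have hR : (coordMatrix h.le * Q.1) * (coordMatrix h.le * Q.1).transpose = 1 := by
    rw [Matrix.transpose_mul, show coordMatrix h.le * Q.1 * (Q.1.transpose *
      (coordMatrix h.le).transpose) = coordMatrix h.le * (Q.1 * Q.1.transpose) *
      (coordMatrix h.le).transpose by simp only [Matrix.mul_assoc], OGroup.mul_transpose,
      Matrix.mul_one, coordMatrix_mul_transpose]
  have hm : Measurable fun x : Fin D → ℝ => ENNReal.ofReal (Real.sqrt (x ⬝ᵥ x -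
      (coordMatrix h.le).mulVec x ⬝ᵥ (coordMatrix h.le).mulVec x)) := by
    simp only [coordMatrix_mulVec, dotProduct, Function.comp_apply]
    fun_prop
  -- Substituting `Q x` for `x` rotates the frame `coordMatrix h.le * Q.1` onto the coordinate
  -- frame.
  rw [det_mul_transpose_mul_coordMatrix_mul, ← lintegral_sqrt_sub_coordMatrix h,
    ← (measurePreserving_mulVec_gaussVec Q).lintegral_comp hm]
  refine Eq.trans ?_
    (lintegral_const_mul _ (hm.comp (measurePreserving_mulVec_gaussVec Q).measurable))
  refine lintegral_congr fun x => ?_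
  rw [det_gram_consRow L _ hR, ← ENNReal.ofReal_mul (Real.sqrt_nonneg _),
    ← Real.sqrt_mul (abs_nonneg _), abs_mul]
  have hx : Q.1.mulVec x ⬝ᵥ Q.1.mulVec x = x ⬝ᵥ x := by
    rw [Matrix.dotProduct_mulVec, ← Matrix.mulVec_transpose, Matrix.mulVec_mulVec,
      OGroup.transpose_mul, Matrix.one_mulVec]
  -- Bessel's inequality, which removes the absolute value.
  have h0 : 0 ≤ x ⬝ᵥ x - (coordMatrix h.le * Q.1).mulVec x ⬝ᵥ (coordMatrix h.le * Q.1).mulVec x := by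
    rw [← Matrix.mulVec_mulVec, ← hx, coordMatrix_mulVec, sub_nonneg]
    generalize Q.1.mulVec x = y
    simp only [dotProduct, Function.comp_apply]
    refine (Finset.sum_map Finset.univ (Fin.castLEEmb h.le) fun i => y i * y i).symm.trans_le ?_
    exact Finset.sum_le_sum_of_subset_of_nonneg (Finset.subset_univ _)
      fun i _ _ => mul_self_nonneg _
  rw [abs_of_nonneg h0, hx, Matrix.mulVec_mulVec]

/-- The mean `2^{d/2} Γ((D+1)/2) / Γ((D-d+1)/2)` of the volume spanned by `d` independent standard
Gaussian vectors of `ℝ^D`. -/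
noncomputable def gaussVolume (d D : ℕ) : ℝ :=
  (2 : ℝ) ^ ((d : ℝ) / 2) * Real.Gamma (((D : ℝ) + 1) / 2) /
    Real.Gamma (((D : ℝ) - (d : ℝ) + 1) / 2)

theorem gaussVolume_pos {d D : ℕ} (h : d ≤ D) : 0 < gaussVolume d D := by
  have h' : (d : ℝ) ≤ D := by exact_mod_cast h
  have h1 := Real.Gamma_pos_of_pos (s := ((D : ℝ) + 1) / 2) (by positivity)
  have h2 := Real.Gamma_pos_of_pos (s := ((D : ℝ) - d + 1) / 2) (by linarith)
  unfold gaussVolume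
  positivity

/-- The numerator of `chiMean (D - d)` cancels the denominator of `gaussVolume d D`, so the product
telescopes. -/
theorem gaussVolume_succ {d D : ℕ} (h : d < D) :
    gaussVolume (d + 1) D = gaussVolume d D * chiMean (D - d) := by
  have h' : (d : ℝ) < D := by exact_mod_cast h
  have h2 := (Real.Gamma_pos_of_pos (s := ((D : ℝ) - d + 1) / 2) (by linarith)).ne'
  have hp : (2 : ℝ) ^ (((d + 1 : ℕ) : ℝ) / 2) = (2 : ℝ) ^ ((d : ℝ) / 2) * Real.sqrt 2 := by
    rw [Real.sqrt_eq_rpow, ← Real.rpow_add two_pos]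
    congr 1
    push_cast
    ring
  unfold gaussVolume chiMean
  rw [hp, Nat.cast_sub h.le, show (D : ℝ) - ((d + 1 : ℕ) : ℝ) + 1 = D - d by push_cast; ring]
  rw [div_mul_div_comm, mul_comm (Real.Gamma (((D : ℝ) - d + 1) / 2)), ← mul_assoc,
    mul_div_mul_right _ _ h2]
  ring

theorem lintegral_gaussMat_succ {d D : ℕ} {f : Matrix (Fin (d + 1)) (Fin D) ℝ → ENNReal}
    (hf : Measurable fun X : Fin (d + 1) → Fin D → ℝ => f (Matrix.of X)) :
    ∫⁻ X, f (Matrix.of X) ∂gaussMat (d + 1) D =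
      ∫⁻ M, ∫⁻ x, f (consRow x (Matrix.of M)) ∂gaussVec D ∂gaussMat d D := by
  have hmp := (measurePreserving_piFinSuccAbove (fun _ : Fin (d + 1) => gaussVec D) 0).symm
  unfold gaussMat
  rw [← hmp.lintegral_comp hf]
  refine (lintegral_prod_symm' (μ := gaussVec D) (ν := Measure.pi fun _ : Fin d => gaussVec D) _
    (hf.comp hmp.measurable)).trans
    (lintegral_congr fun M => lintegral_congr fun x => congrArg f ?_)
  exact congrArg Matrix.of (Fin.insertNth_zero' x M)

theorem lintegral_sqrt_det_gram_gaussMat {d D : ℕ} (h : d ≤ D) :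
    ∫⁻ X, ENNReal.ofReal (Real.sqrt |(Matrix.of X * (Matrix.of X).transpose).det|)
      ∂gaussMat d D = ENNReal.ofReal (gaussVolume d D) := by
  induction d with
  | zero =>
    have h1 := (Real.Gamma_pos_of_pos (s := ((D : ℝ) + 1) / 2) (by positivity)).ne'
    simp [gaussVolume, h1]
  | succ d ih =>
    have hm : ∀ d, Measurable fun X : Fin d → Fin D → ℝ =>
        ENNReal.ofReal (Real.sqrt |(Matrix.of X * (Matrix.of X).transpose).det|) := fun d =>
      (measurable_sqrt_abs_det_gram fun i j => by
        simp only [Matrix.of_apply]; fun_prop).ennreal_ofReal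
    rw [lintegral_gaussMat_succ (f := fun X => ENNReal.ofReal (Real.sqrt |(X * X.transpose).det|))
      (hm (d + 1))]
    simp only [lintegral_sqrt_det_gram_consRow (Nat.lt_of_succ_le h)]
    rw [lintegral_mul_const _ (hm d), ih (by omega), gaussVolume_succ (Nat.lt_of_succ_le h),
      ENNReal.ofReal_mul (gaussVolume_pos (by omega)).le]

theorem integral_sqrt_det_gram_gaussMat {d D : ℕ} (h : d ≤ D) :
    Integrable (fun X => Real.sqrt |(Matrix.of X * (Matrix.of X).transpose).det|) (gaussMat d D) ∧
    ∫ X, Real.sqrt |(Matrix.of X * (Matrix.of X).transpose).det| ∂gaussMat d D =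
      gaussVolume d D := by
  have hm : Measurable fun X : Fin d → Fin D → ℝ =>
      Real.sqrt |(Matrix.of X * (Matrix.of X).transpose).det| :=
    measurable_sqrt_abs_det_gram fun i j => by simp only [Matrix.of_apply]; fun_prop
  have h0 : ∀ X : Fin d → Fin D → ℝ,
      0 ≤ Real.sqrt |(Matrix.of X * (Matrix.of X).transpose).det| := fun X => Real.sqrt_nonneg _
  refine ⟨⟨hm.aestronglyMeasurable, ?_⟩, ?_⟩
  · rw [hasFiniteIntegral_iff_ofReal (Filter.Eventually.of_forall h0),
      lintegral_sqrt_det_gram_gaussMat h]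
    exact ENNReal.ofReal_lt_top
  · rw [integral_eq_lintegral_of_nonneg_ae (Filter.Eventually.of_forall h0)
      hm.aestronglyMeasurable, lintegral_sqrt_det_gram_gaussMat h,
      ENNReal.toReal_ofReal (gaussVolume_pos h).le]

/-! ### Averages over the orthogonal group -/

/-- The mean over the orthogonal group of the absolute value of the leading minor of size `d`. -/
noncomputable def minorMean {d D : ℕ} (h : d ≤ D) : ENNReal :=
  ∫⁻ Q : OGroup D, ENNReal.ofReal |(coordMatrix h * Q.1 * (coordMatrix h).transpose).det|
    ∂OGroup.haarProb D

theorem OGroup.measurable_entry {D : ℕ} (i j : Fin D) :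
    Measurable fun Q : OGroup D => Q.1 i j :=
  ((continuous_subtype_val : Continuous fun Q : OGroup D => Q.1).matrix_elem i j).measurable

theorem measurable_abs_det_mul_coordMatrix {d D : ℕ} (h : d ≤ D) (M : Matrix (Fin d) (Fin D) ℝ) :
    Measurable fun Q : OGroup D =>
      ENNReal.ofReal |(M * Q.1 * (coordMatrix h).transpose).det| :=
  (_root_.continuous_abs.measurable.comp (measurable_det_of_entries
    (measurable_mul_entries (A := fun Q : OGroup D => M * Q.1)
      (B := fun _ => (coordMatrix h).transpose)
      (measurable_mul_entries (A := fun _ => M) (B := fun Q : OGroup D => Q.1)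
        (fun _ _ => measurable_const) OGroup.measurable_entry)
      fun _ _ => measurable_const))).ennreal_ofReal

/-- The factor `det L` comes out of the determinant, and the substitution `Q ↦ R * Q` removes the
rest of the dependence on `M`. -/
theorem lintegral_abs_det_haarProb {d D : ℕ} (h : d ≤ D) (M : Matrix (Fin d) (Fin D) ℝ) :
    ∫⁻ Q : OGroup D, ENNReal.ofReal |(M * Q.1 * (coordMatrix h).transpose).det|
      ∂OGroup.haarProb D =
      ENNReal.ofReal (Real.sqrt |(M * M.transpose).det|) * minorMean h := by
  obtain ⟨L, R, rfl⟩ := exists_eq_mul_coordMatrix_mul h M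
  have : (OGroup.haarProb D).IsMulLeftInvariant := by unfold OGroup.haarProb; infer_instance
  rw [det_mul_transpose_mul_coordMatrix_mul, abs_of_nonneg (sq_nonneg _), Real.sqrt_sq_eq_abs,
    minorMean, ← lintegral_const_mul _ (measurable_abs_det_mul_coordMatrix h (coordMatrix h))]
  conv_rhs => rw [← lintegral_mul_left_eq_self _ R]
  refine lintegral_congr fun Q => ?_
  rw [← ENNReal.ofReal_mul (abs_nonneg _), ← abs_mul, ← Matrix.det_mul]
  simp only [Matrix.mul_assoc, Submonoid.coe_mul]

/-- Tonelli for Haar times Gaussian measure: for each fixed `Q`, the first `d` columns of `X Q` form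
a square Gaussian matrix, so the inner integral does not depend on `Q`. -/
theorem minorMean_mul_gaussVolume {d D : ℕ} (h : d ≤ D) :
    ENNReal.ofReal (gaussVolume d D) * minorMean h = ENNReal.ofReal (gaussVolume d d) := by
  have hmX : Measurable fun X : Fin d → Fin D → ℝ =>
      ENNReal.ofReal (Real.sqrt |(Matrix.of X * (Matrix.of X).transpose).det|) :=
    (measurable_sqrt_abs_det_gram fun i j => by
      simp only [Matrix.of_apply]; fun_prop).ennreal_ofReal
  rw [← lintegral_sqrt_det_gram_gaussMat h, ← lintegral_mul_const _ hmX]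
  simp only [← lintegral_abs_det_haarProb h]
  have hjoint : Measurable fun p : (Fin d → Fin D → ℝ) × OGroup D =>
      ENNReal.ofReal |(Matrix.of p.1 * p.2.1 * (coordMatrix h).transpose).det| :=
    (_root_.continuous_abs.measurable.comp (measurable_det_of_entries
      (measurable_mul_entries
        (A := fun p : (Fin d → Fin D → ℝ) × OGroup D => Matrix.of p.1 * p.2.1)
        (B := fun _ => (coordMatrix h).transpose)
        (measurable_mul_entries (A := fun p : (Fin d → Fin D → ℝ) × OGroup D => Matrix.of p.1)
          (B := fun p => p.2.1) (fun i j => by simp only [Matrix.of_apply]; fun_prop)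
          fun i j => (OGroup.measurable_entry i j).comp measurable_snd)
        fun _ _ => measurable_const))).ennreal_ofReal
  have hsq : Measurable fun Y : Fin d → Fin d → ℝ => ENNReal.ofReal |(Matrix.of Y).det| :=
    (_root_.continuous_abs.measurable.comp (measurable_det_of_entries fun i j => by
      simp only [Matrix.of_apply]; fun_prop)).ennreal_ofReal
  have hinner : ∀ Q : OGroup D, ∫⁻ X,
      ENNReal.ofReal |(Matrix.of X * Q.1 * (coordMatrix h).transpose).det| ∂gaussMat d D =
      ENNReal.ofReal (gaussVolume d d) := fun Q => by
    rw [← lintegral_sqrt_det_gram_gaussMat le_rfl]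
    simp only [Matrix.det_mul, Matrix.det_transpose, abs_mul_self, Real.sqrt_mul_self_eq_abs]
    rw [← ((measurePreserving_submatrix_gaussMat (Fin.castLE h) (Fin.castLE_injective h)).comp
      (measurePreserving_mul_gaussMat Q)).lintegral_comp hsq]
    refine lintegral_congr fun X => ?_
    rw [mul_coordMatrix_transpose]
    rfl
  rw [lintegral_lintegral_swap hjoint.aemeasurable]
  simp [hinner]

/-! ### From the orthogonal group to the Grassmannian -/

theorem Grass.IsProjectorMatrix.mul_transpose {D d : ℕ} {V : Grass D d}
    {P : Matrix (Fin d) (Fin D) ℝ} (hP : V.IsProjectorMatrix P) : P * P.transpose = 1 := by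
  ext i j
  have := orthonormal_iff_ite.1 hP.1 i j
  rw [Matrix.one_apply, ← this]
  simp [Matrix.mul_apply, PiLp.inner_apply, mul_comm]

theorem Grass.IsProjectorMatrix.starProjection_apply {D d : ℕ} {V : Grass D d}
    {P : Matrix (Fin d) (Fin D) ℝ} (hP : V.IsProjectorMatrix P) (x : EuclideanSpace ℝ (Fin D)) :
    V.1.starProjection x = WithLp.toLp 2 ((P.transpose * P).mulVec x.ofLp) := by
  have hinner : ∀ (u : Fin D → ℝ) (i : Fin d),
      inner ℝ (WithLp.toLp 2 u : EuclideanSpace ℝ (Fin D)) (WithLp.toLp 2 (P i)) =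
        P.mulVec u i := fun u i => by
    simp [PiLp.inner_apply, Matrix.mulVec, dotProduct]
  refine Submodule.eq_starProjection_of_mem_of_inner_eq_zero ?_ ?_
  · have : WithLp.toLp 2 ((P.transpose * P).mulVec x.ofLp) =
        ∑ i, P.mulVec x.ofLp i • (WithLp.toLp 2 (P i) : EuclideanSpace ℝ (Fin D)) := by
      rw [← Matrix.mulVec_mulVec]
      ext j
      simp [Matrix.mulVec, dotProduct, mul_comm]
    rw [this, ← hP.2]
    exact Submodule.sum_mem _ fun i _ =>
      Submodule.smul_mem _ _ (Submodule.subset_span ⟨i, rfl⟩)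
  · intro w hw
    rw [← hP.2] at hw
    induction hw using Submodule.span_induction with
    | mem w hw =>
      obtain ⟨i, rfl⟩ := hw
      have : x - WithLp.toLp 2 ((P.transpose * P).mulVec x.ofLp) =
        WithLp.toLp 2 (x.ofLp - (P.transpose * P).mulVec x.ofLp) := rfl
      rw [this, hinner, Matrix.mulVec_sub, Matrix.mulVec_mulVec, ← Matrix.mul_assoc,
        hP.mul_transpose, Matrix.one_mul, sub_self, Pi.zero_apply]
    | zero => exact inner_zero_right _
    | add a b _ _ ha hb => rw [inner_add_right, ha, hb, add_zero]
    | smul c a _ ha => rw [inner_smul_right, ha, mul_zero]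

theorem Grass.IsProjectorMatrix.transpose_mul_apply {D d : ℕ} {V : Grass D d}
    {P : Matrix (Fin d) (Fin D) ℝ} (hP : V.IsProjectorMatrix P) (i j : Fin D) :
    (P.transpose * P) i j = (V.1.starProjection (EuclideanSpace.single j 1)) i := by
  rw [hP.starProjection_apply]
  simp

/-- The right side sees `P` only through `Pᵀ P`, the matrix of the orthogonal projector. This gives
both independence of the basis and measurability in `V`. -/
theorem abs_det_mul_transpose_eq_sqrt {d D : ℕ} (M P : Matrix (Fin d) (Fin D) ℝ) :
    |(M * P.transpose).det| = Real.sqrt |(M * (P.transpose * P) * M.transpose).det| := by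
  rw [show M * (P.transpose * P) * M.transpose =
    (M * P.transpose) * (M * P.transpose).transpose by
      rw [Matrix.transpose_mul, Matrix.transpose_transpose]; simp only [Matrix.mul_assoc],
    Matrix.det_mul (M * P.transpose), Matrix.det_transpose, abs_mul_self,
    Real.sqrt_mul_self_eq_abs]

theorem Grass.IsProjectorMatrix.abs_det_eq {D d : ℕ} {V : Grass D d}
    {P P' : Matrix (Fin d) (Fin D) ℝ} (hP : V.IsProjectorMatrix P) (hP' : V.IsProjectorMatrix P')
    (M : Matrix (Fin d) (Fin D) ℝ) : |(M * P.transpose).det| = |(M * P'.transpose).det| := by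
  have : P.transpose * P = P'.transpose * P' := by
    ext i j
    rw [hP.transpose_mul_apply, hP'.transpose_mul_apply]
  rw [abs_det_mul_transpose_eq_sqrt, this, ← abs_det_mul_transpose_eq_sqrt]

theorem Grass.isProjectorMatrix_act_base {D d : ℕ} (h : d ≤ D) (Q : OGroup D) :
    (Grass.act Q (Grass.base h)).IsProjectorMatrix (coordMatrix h * Q.1.transpose) := by
  have hrow : ∀ i : Fin d,
      (WithLp.toLp 2 ((coordMatrix h * Q.1.transpose) i) : EuclideanSpace ℝ (Fin D)) =
        OGroup.toIsometry Q (EuclideanSpace.basisFun (Fin D) ℝ (Fin.castLE h i)) := fun i => by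
    rw [coordMatrix_mul, OGroup.toIsometry_apply]
    ext j
    simp
  unfold Grass.IsProjectorMatrix
  simp only [hrow]
  refine ⟨((EuclideanSpace.basisFun (Fin D) ℝ).orthonormal.comp _
    (Fin.castLE_injective h)).comp_linearIsometry (OGroup.toIsometry Q).toLinearIsometry, ?_⟩
  simp only [Grass.act, Grass.base, Submodule.map_span, ← Set.range_comp]
  rfl

/-- The choice `π` need not be measurable; only the entries of the projector enter, and these are
continuous in `V`. -/
theorem Grass.measurable_abs_det {D d : ℕ} (M : Matrix (Fin d) (Fin D) ℝ)
    {π : Grass D d → Matrix (Fin d) (Fin D) ℝ} (hπ : ∀ V, Grass.IsProjectorMatrix V (π V)) :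
    Measurable fun V => |(M * (π V).transpose).det| := by
  rw [funext fun V => abs_det_mul_transpose_eq_sqrt M (π V)]
  have hentry : ∀ i j, Measurable fun V : Grass D d => ((π V).transpose * π V) i j := by
    intro i j
    simp only [(hπ _).transpose_mul_apply]
    have h1 : Continuous fun V : Grass D d => V.1.starProjection := continuous_induced_dom
    have h2 : Continuous fun V : Grass D d =>
        V.1.starProjection (EuclideanSpace.single j (1 : ℝ)) := h1.clm_apply continuous_const
    exact ((EuclideanSpace.proj (𝕜 := ℝ) i).continuous.comp h2).measurable
  exact (_root_.continuous_abs.measurable.comp (measurable_det_of_entries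
    (measurable_mul_entries (A := fun V => M * ((π V).transpose * π V))
      (B := fun _ => M.transpose)
      (measurable_mul_entries (A := fun _ => M) (B := fun V => (π V).transpose * π V)
        (fun _ _ => measurable_const) hentry) fun _ _ => measurable_const))).sqrt

theorem Grass.lintegral_abs_det {D d : ℕ} (h : d ≤ D) (M : Matrix (Fin d) (Fin D) ℝ)
    {π : Grass D d → Matrix (Fin d) (Fin D) ℝ} (hπ : ∀ V, Grass.IsProjectorMatrix V (π V)) :
    ∫⁻ V, ENNReal.ofReal |(M * (π V).transpose).det| ∂Grass.invMeasure h =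
      ENNReal.ofReal (Real.sqrt |(M * M.transpose).det|) * minorMean h := by
  rw [Grass.invMeasure, lintegral_map (Grass.measurable_abs_det M hπ).ennreal_ofReal
    (Grass.measurable_act_base h), ← lintegral_abs_det_haarProb]
  refine lintegral_congr fun Q => ?_
  rw [(hπ _).abs_det_eq (Grass.isProjectorMatrix_act_base h Q), Matrix.transpose_mul,
    Matrix.transpose_transpose, Matrix.mul_assoc]

/-! ### The constant and the conclusion -/

theorem minorMean_eq {d D : ℕ} (h : d ≤ D) :
    minorMean h = ENNReal.ofReal (gaussVolume d d / gaussVolume d D) := by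
  have h0 := gaussVolume_pos h
  rw [ENNReal.ofReal_div_of_pos h0, ENNReal.eq_div_iff (ENNReal.ofReal_pos.2 h0).ne'
    ENNReal.ofReal_ne_top, minorMean_mul_gaussVolume h]

/-- The `√π` of the Crofton constant is the `Γ(1/2)` in the denominator of `gaussVolume d d`; the
powers of 2 cancel. -/
theorem croftonConst_mul_gaussVolume_div {d D : ℕ} (h : d ≤ D) :
    croftonConst D (D - d) * (gaussVolume d d / gaussVolume d D) = 1 := by
  have h' : (d : ℝ) ≤ D := by exact_mod_cast h
  have h1 := (Real.Gamma_pos_of_pos (s := ((D : ℝ) + 1) / 2) (by positivity)).ne'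
  have h2 := (Real.Gamma_pos_of_pos (s := ((D : ℝ) - d + 1) / 2) (by linarith)).ne'
  have h3 := (Real.Gamma_pos_of_pos (s := ((d : ℝ) + 1) / 2) (by positivity)).ne'
  have h4 : Real.sqrt Real.pi ≠ 0 := (Real.sqrt_pos.2 Real.pi_pos).ne'
  have h5 : (2 : ℝ) ^ ((d : ℝ) / 2) ≠ 0 := (Real.rpow_pos_of_pos two_pos _).ne'
  unfold croftonConst gaussVolume
  rw [Nat.cast_sub h, sub_self, zero_add, Real.Gamma_one_half_eq, sub_sub_cancel]
  field_simp

theorem Grass.integral_abs_det {D d : ℕ} (h : d ≤ D) (M : Matrix (Fin d) (Fin D) ℝ)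
    {π : Grass D d → Matrix (Fin d) (Fin D) ℝ} (hπ : ∀ V, Grass.IsProjectorMatrix V (π V)) :
    Integrable (fun V => |(M * (π V).transpose).det|) (Grass.invMeasure h) ∧
      ∫ V, |(M * (π V).transpose).det| ∂Grass.invMeasure h =
        Real.sqrt |(M * M.transpose).det| * (gaussVolume d d / gaussVolume d D) := by
  have hm := (Grass.measurable_abs_det M hπ).aestronglyMeasurable (μ := Grass.invMeasure h)
  have h0 : 0 ≤ᵐ[Grass.invMeasure h] fun V => |(M * (π V).transpose).det| :=
    Filter.Eventually.of_forall fun V => abs_nonneg _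
  have hl := Grass.lintegral_abs_det h M hπ
  rw [minorMean_eq, ← ENNReal.ofReal_mul (Real.sqrt_nonneg _)] at hl
  refine ⟨⟨hm, ?_⟩, ?_⟩
  · rw [hasFiniteIntegral_iff_ofReal h0, hl]
    exact ENNReal.ofReal_lt_top
  · rw [integral_eq_lintegral_of_nonneg_ae h0 hm, hl, ENNReal.toReal_ofReal]
    have h1 := gaussVolume_pos h
    have h2 := gaussVolume_pos (le_refl d)
    positivity

theorem mainTheorem7 (d D : ℕ) (h : d ≤ D) :
    (∀ (M : Matrix (Fin d) (Fin D) ℝ) (π : Grass D d → Matrix (Fin d) (Fin D) ℝ),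
      (∀ V, Grass.IsProjectorMatrix V (π V)) →
        Integrable (fun V => |(M * (π V).transpose).det|) (Grass.invMeasure h) ∧
        Real.sqrt |(M * M.transpose).det| =
          croftonConst D (D - d) *
            ∫ V, |(M * (π V).transpose).det| ∂(Grass.invMeasure h)) ∧
    (∀ (Ω : Type*) [MeasurableSpace Ω] (P : Measure Ω) [IsProbabilityMeasure P]
      (X : Ω → Matrix (Fin d) (Fin D) ℝ), IsStdGaussianMatrix X P →
        Integrable (fun ω => Real.sqrt |(X ω * (X ω).transpose).det|) P ∧
        ∫ ω, Real.sqrt |(X ω * (X ω).transpose).det| ∂P =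
          (2 : ℝ) ^ ((d : ℝ) / 2) * Real.Gamma (((D : ℝ) + 1) / 2) /
            Real.Gamma (((D : ℝ) - (d : ℝ) + 1) / 2)) := by
  refine ⟨fun M π hπ => ?_, fun Ω _ P _ X hX => ?_⟩
  · obtain ⟨hi, he⟩ := Grass.integral_abs_det h M hπ
    refine ⟨hi, ?_⟩
    rw [he, mul_left_comm, croftonConst_mul_gaussVolume_div h, mul_one]
  · have hlaw := hX.hasLaw_gaussMat
    obtain ⟨hi, he⟩ := integral_sqrt_det_gram_gaussMat h
    rw [← hlaw.map_eq] at hi he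
    refine ⟨hi.comp_aemeasurable hlaw.aemeasurable, ?_⟩
    rw [integral_map hlaw.aemeasurable hi.aestronglyMeasurable] at he
    exact he
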